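/- Let $\ell>0$, $I=[0,\ell]$, and let $L^1=L^1(I,\mathbb R)$ carry the norm $\|\cdot\|_1$. For $q\in L^1$ a real number $\lambda$ is called a Dirichlet eigenvalue of $q$ if there is a function $z$ on $I$, not identically zero, with $z'$ absolutely continuous on $I$, such that $-z''+q(x)z=\lambda z$ almost everywhere on $I$ and $z(0)=z(\ell)=0$. **Theorem.** Every $q\in L^1$ has a smallest Dirichlet eigenvalue $\lambda_1^D(q)$; the functional $\lambda_1^D:L^1\to\mathbb R$ is twice continuously Fréchet differentiable; and its second-order derivative in the potential, $$\partial_{qq}\lambda_1^D(q)(h):=\frac{d^2}{ds^2}\lambda_1^D(q+sh)\Big|_{s=0},$$ satisfies $\partial_{qq}\lambda_1^D(q)(h)\le 0$ for all $q,h\in L^1$. -/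

import Mathlib

open MeasureTheory Set

/-- The real Banach space `L¹(I, ℝ)` of integrable potentials on `I = [0, ℓ]`, with the `L¹` norm. -/
abbrev Potential (ℓ : ℝ) : Type := Lp ℝ 1 (volume.restrict (Icc (0 : ℝ) ℓ))

/-- `z` is a (Carathéodory) solution of `-z'' + q z = lam z` on `[0, ℓ]`, with first derivative `w`:
`z' = w` everywhere on `[0, ℓ]` (one-sided at the end points), `w` is absolutely continuous on
`[0, ℓ]` (hence differentiable almost everywhere), and the equation holds almost everywhere. -/
def IsSturmLiouvilleSolution (ℓ : ℝ) (q : ℝ → ℝ) (lam : ℝ) (z w : ℝ → ℝ) : Prop :=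
  (∀ x ∈ Icc (0 : ℝ) ℓ, HasDerivWithinAt z (w x) (Icc (0 : ℝ) ℓ) x) ∧
  AbsolutelyContinuousOnInterval w 0 ℓ ∧
  ∀ᵐ x ∂volume.restrict (Icc (0 : ℝ) ℓ), -deriv w x + q x * z x = lam * z x

/-- `lam` is a Dirichlet eigenvalue for the potential `q`: there is a solution of
`-z'' + q z = lam z`, not identically zero on `[0, ℓ]`, with `z 0 = z ℓ = 0`. -/
def IsDirichletEigenvalue (ℓ : ℝ) (q : Potential ℓ) (lam : ℝ) : Prop :=
  ∃ z w : ℝ → ℝ, IsSturmLiouvilleSolution ℓ q lam z w ∧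
    z 0 = 0 ∧ z ℓ = 0 ∧ ∃ x ∈ Icc (0 : ℝ) ℓ, z x ≠ 0

/-- The first (smallest) Dirichlet eigenvalue, as a nonlinear functional of the potential. -/
noncomputable def firstDirichletEigenvalue (ℓ : ℝ) (q : Potential ℓ) : ℝ :=
  sInf {lam : ℝ | IsDirichletEigenvalue ℓ q lam}

/-- The second-order derivative of `F` at `q` in the direction `h`: the second derivative of
`s ↦ F (q + s h)` at `s = 0`. -/
noncomputable def secondFrechetDeriv {E : Type*} [NormedAddCommGroup E] [NormedSpace ℝ E]
    (F : E → ℝ) (q h : E) : ℝ :=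
  iteratedDeriv 2 (fun s : ℝ => F (q + s • h)) 0

open scoped BoundedContinuousFunction

/-! The proof is a shooting argument. Let y = `sol p` solve y'' = p y, y(0) = 0, y'(0) = 1. Then λ
is a Dirichlet eigenvalue of q exactly when `sol (q - lam • one ℓ)` vanishes at ℓ
(`isDirichletEigenvalue_iff`). The integral equation for y' is (1 - V) y' = 1 with V linear in p and
1 - V invertible (`isUnit_one_sub_volterra`), so y depends smoothly on p in L¹.

The first eigenvalue is a threshold: λ < λ₁(q) if and only if the solution for q - λ is positive on
(0, ℓ] (disconjugacy). Instead of a Rayleigh quotient, Picone's identity is used: if y(c) = 0 and p₀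
is disconjugate, then ∫₀ᶜ (p - p₀) y² < 0 (`integral_sub_mul_sq_neg`). This inequality is affine in
p₀, so every potential lying above a convex combination of disconjugate ones is disconjugate.
Monotonicity in λ, finiteness of the threshold and concavity of λ₁ all follow from that.

For smoothness the implicit function theorem is applied to y(ℓ) as a function of (q, λ). At a zero,
y'(ℓ) ∂y(ℓ)/∂λ = ∫ y² > 0, so the λ-derivative does not vanish; continuity of λ₁ shows that the
implicit branch is λ₁ itself. A C² concave function has nonpositive second derivative along every
line. -/

/-- Lebesgue measure on `[0, ℓ]`. -/
noncomputable abbrev intervalMeasure (ℓ : ℝ) : Measure ℝ := volume.restrict (Icc (0 : ℝ) ℓ)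

/-! ### Integration against an L¹ potential as a bounded bilinear map -/

namespace Potential

variable {ℓ : ℝ}

theorem integrable (p : Potential ℓ) : Integrable p (intervalMeasure ℓ) := L1.integrable_coeFn p

theorem integrable_mul (p : Potential ℓ) (u : ℝ →ᵇ ℝ) :
    Integrable (fun t => p t * u t) (intervalMeasure ℓ) :=
  p.integrable.mul_bdd u.continuous.aestronglyMeasurable (c := ‖u‖)
    (Filter.Eventually.of_forall fun t => u.norm_coe_le_norm t)

theorem integral_abs_eq_norm (p : Potential ℓ) : ∫ t, |p t| ∂(intervalMeasure ℓ) = ‖p‖ :=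
  (L1.norm_eq_integral_norm p).symm

theorem _root_.intervalIntegral.abs_integral_le_integral_norm_uIoc {f : ℝ → ℝ} {μ : Measure ℝ}
    {a b : ℝ} : |∫ t in a..b, f t ∂μ| ≤ ∫ t in uIoc a b, ‖f t‖ ∂μ := by
  rw [← Real.norm_eq_abs]
  exact intervalIntegral.norm_integral_le_integral_norm_uIoc

theorem abs_intervalIntegral_mul_le (p : Potential ℓ) (u : ℝ →ᵇ ℝ) (x : ℝ) :
    |∫ t in 0..x, p t * u t ∂(intervalMeasure ℓ)| ≤ ‖p‖ * ‖u‖ := by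
  have h1 : |∫ t in 0..x, p t * u t ∂(intervalMeasure ℓ)|
      ≤ ∫ t in uIoc 0 x, ‖p t * u t‖ ∂(intervalMeasure ℓ) :=
    intervalIntegral.abs_integral_le_integral_norm_uIoc
  have h2 : ∫ t in uIoc 0 x, ‖p t * u t‖ ∂(intervalMeasure ℓ)
      ≤ ∫ t, ‖p t * u t‖ ∂(intervalMeasure ℓ) :=
    setIntegral_le_integral (p.integrable_mul u).norm
      (Filter.Eventually.of_forall fun t => norm_nonneg _)
  have h3 : ∫ t, ‖p t * u t‖ ∂(intervalMeasure ℓ) ≤ ∫ t, |p t| * ‖u‖ ∂(intervalMeasure ℓ) := by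
    refine integral_mono (p.integrable_mul u).norm (p.integrable.norm.mul_const _) fun t => ?_
    rw [norm_mul]
    exact mul_le_mul_of_nonneg_left (u.norm_coe_le_norm t) (norm_nonneg _)
  rw [integral_mul_const, integral_abs_eq_norm] at h3
  linarith

/-- The primitive of `p * u` vanishing at `0`. -/
noncomputable def primitiveMul (p : Potential ℓ) (u : ℝ →ᵇ ℝ) : ℝ →ᵇ ℝ :=
  BoundedContinuousFunction.ofNormedAddCommGroup
    (fun x => ∫ t in 0..x, p t * u t ∂(intervalMeasure ℓ))
    (intervalIntegral.continuous_primitive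
      (fun _ _ => (p.integrable_mul u).intervalIntegrable) 0)
    (‖p‖ * ‖u‖) (fun x => abs_intervalIntegral_mul_le p u x)

theorem primitiveMul_apply (p : Potential ℓ) (u : ℝ →ᵇ ℝ) (x : ℝ) :
    primitiveMul p u x = ∫ t in 0..x, p t * u t ∂(intervalMeasure ℓ) := rfl

/-- `primitiveMul` as a bounded bilinear map. -/
noncomputable def primitiveMulL (ℓ : ℝ) : Potential ℓ →L[ℝ] (ℝ →ᵇ ℝ) →L[ℝ] (ℝ →ᵇ ℝ) :=
  LinearMap.mkContinuous₂
    (LinearMap.mk₂ ℝ primitiveMul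
      (fun p p' u => by
        ext x
        simp only [primitiveMul_apply, BoundedContinuousFunction.add_apply]
        rw [← intervalIntegral.integral_add (p.integrable_mul u).intervalIntegrable
          (p'.integrable_mul u).intervalIntegrable]
        refine intervalIntegral.integral_congr_ae ?_
        filter_upwards [Lp.coeFn_add p p'] with t ht _
        rw [ht, Pi.add_apply, add_mul])
      (fun c p u => by
        ext x
        simp only [primitiveMul_apply, BoundedContinuousFunction.coe_smul]
        rw [smul_eq_mul, ← intervalIntegral.integral_const_mul]
        refine intervalIntegral.integral_congr_ae ?_
        filter_upwards [Lp.coeFn_smul c p] with t ht _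
        rw [ht, Pi.smul_apply, smul_eq_mul, mul_assoc])
      (fun p u u' => by
        ext x
        simp only [primitiveMul_apply, BoundedContinuousFunction.add_apply]
        rw [← intervalIntegral.integral_add (p.integrable_mul u).intervalIntegrable
          (p.integrable_mul u').intervalIntegrable]
        simp only [mul_add])
      (fun c p u => by
        ext x
        simp only [primitiveMul_apply, BoundedContinuousFunction.coe_smul, smul_eq_mul]
        rw [← intervalIntegral.integral_const_mul]
        simp only [mul_left_comm]))
    1 (fun p u => by
      rw [one_mul]
      exact BoundedContinuousFunction.norm_ofNormedAddCommGroup_le _ (by positivity)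
        (abs_intervalIntegral_mul_le p u))

theorem primitiveMulL_apply (p : Potential ℓ) (u : ℝ →ᵇ ℝ) (x : ℝ) :
    primitiveMulL ℓ p u x = ∫ t in 0..x, p t * u t ∂(intervalMeasure ℓ) := rfl

/-- The constant potential `1`. -/
noncomputable def one (ℓ : ℝ) : Potential ℓ := Lp.const 1 (intervalMeasure ℓ) (1 : ℝ)

theorem coeFn_one : ∀ᵐ t ∂(intervalMeasure ℓ), one ℓ t = 1 := Lp.coeFn_const 1 _ (1 : ℝ)

/-- Integration from `0`. -/
noncomputable def primitive (ℓ : ℝ) : (ℝ →ᵇ ℝ) →L[ℝ] (ℝ →ᵇ ℝ) := primitiveMulL ℓ (one ℓ)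

theorem primitive_apply (u : ℝ →ᵇ ℝ) (x : ℝ) :
    primitive ℓ u x = ∫ t in 0..x, u t ∂(intervalMeasure ℓ) := by
  rw [primitive, primitiveMulL_apply]
  refine intervalIntegral.integral_congr_ae ?_
  filter_upwards [coeFn_one (ℓ := ℓ)] with t ht _
  rw [ht, one_mul]

theorem intervalIntegral_restrict {f : ℝ → ℝ} {a b : ℝ} (ha : a ∈ Icc 0 ℓ) (hb : b ∈ Icc 0 ℓ) :
    ∫ t in a..b, f t ∂(intervalMeasure ℓ) = ∫ t in a..b, f t := by
  have key : ∀ {a b : ℝ}, a ∈ Icc 0 ℓ → b ∈ Icc 0 ℓ →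
      (intervalMeasure ℓ).restrict (Ioc a b) = volume.restrict (Ioc a b) := by
    intro a b ha hb
    rw [Measure.restrict_restrict measurableSet_Ioc]
    congr 1
    exact inter_eq_left.2 fun t ht => ⟨ha.1.trans ht.1.le, ht.2.trans hb.2⟩
  rw [intervalIntegral, intervalIntegral, key ha hb, key hb ha]

theorem intervalIntegral_of_nonpos {f : ℝ → ℝ} {x : ℝ} (hx : x ≤ 0) :
    ∫ t in 0..x, f t ∂(intervalMeasure ℓ) = 0 := by
  rw [intervalIntegral.integral_of_ge hx, Measure.restrict_restrict measurableSet_Ioc,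
    Measure.restrict_eq_zero.2, integral_zero_measure, neg_zero]
  refine measure_mono_null (t := {0}) ?_ (by simp)
  rintro t ⟨ht, ht'⟩
  exact le_antisymm ht.2 ht'.1

/-! ### Invertibility of the Volterra equation -/

theorem _root_.LipschitzOnWith.comp_absolutelyContinuousOnInterval {φ f : ℝ → ℝ} {K : NNReal}
    {a b : ℝ} {s : Set ℝ} (hφ : LipschitzOnWith K φ s)
    (hf : AbsolutelyContinuousOnInterval f a b) (hs : MapsTo f (uIcc a b) s) :
    AbsolutelyContinuousOnInterval (fun x => φ (f x)) a b := by
  rw [absolutelyContinuousOnInterval_iff] at hf ⊢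
  intro ε hε
  obtain ⟨δ, hδ, h⟩ := hf (ε / (K + 1)) (by positivity)
  refine ⟨δ, hδ, fun E hE hEδ => ?_⟩
  have h1 := h E hE hEδ
  calc _ ≤ ∑ i ∈ Finset.range E.1, (K + 1) * dist (f (E.2 i).1) (f (E.2 i).2) := by
        refine Finset.sum_le_sum fun i hi => ?_
        refine (hφ.dist_le_mul _ (hs (hE.1 i hi).1) _ (hs (hE.1 i hi).2)).trans ?_
        gcongr
        simp
    _ < ε := by
        rw [← Finset.mul_sum]
        rwa [lt_div_iff₀' (by positivity)] at h1

/-- The integrand is almost everywhere k⁻¹ times the derivative of the absolutely continuous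
function exp(k ∫g); the boundary term at 0 has a favourable sign and is dropped. -/
theorem integral_mul_exp_primitive_le {g : ℝ → ℝ} (hg : Integrable g volume)
    {k : ℝ} (hk : 0 < k) {x : ℝ} :
    ∫ t in 0..x, g t * Real.exp (k * ∫ s in 0..t, g s) ≤
      k⁻¹ * Real.exp (k * ∫ s in 0..x, g s) := by
  set P : ℝ → ℝ := fun t => ∫ s in 0..t, g s with hP
  have hPac : AbsolutelyContinuousOnInterval P 0 x :=
    hg.intervalIntegrable.absolutelyContinuousOnInterval_intervalIntegral (by simp)
  obtain ⟨C, hC⟩ := (hPac.const_mul k).exists_bound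
  obtain ⟨K, hK⟩ := (Real.contDiff_exp (n := 1)).contDiffOn.exists_lipschitzOnWith (s := Icc (-C) C)
    (by decide) (convex_Icc _ _) isCompact_Icc
  have hac : AbsolutelyContinuousOnInterval (fun t => Real.exp (k * P t)) 0 x :=
    hK.comp_absolutelyContinuousOnInterval (hPac.const_mul k) fun t ht => abs_le.1 (hC t ht)
  have h1 : ∫ t in 0..x, k * (g t * Real.exp (k * P t)) =
      Real.exp (k * P x) - Real.exp (k * P 0) := by
    rw [← hac.integral_deriv_eq_sub]
    refine intervalIntegral.integral_congr_ae ?_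
    filter_upwards [(hg.intervalIntegrable (a := 0) (b := x)).ae_hasDerivAt_integral] with t ht htx
    have := ((ht (uIoc_subset_uIcc htx) 0 (by simp)).const_mul k).exp
    rw [this.deriv]
    ring
  rw [intervalIntegral.integral_const_mul] at h1
  rw [le_inv_mul_iff₀ hk, h1]
  have := Real.exp_pos (k * P 0)
  linarith

/-- The Volterra operator whose fixed-point equation is the initial value problem for
`y'' = p y`, written in terms of `y'`. -/
noncomputable def volterra (p : Potential ℓ) : (ℝ →ᵇ ℝ) →L[ℝ] (ℝ →ᵇ ℝ) :=
  primitiveMulL ℓ p ∘L primitive ℓ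

/-- Allows passing to a weighted norm by conjugation, without changing the space. -/
theorem isUnit_one_sub_of_conj {A : Type*} [Ring A] {r r' v : A} (h : r * r' = 1)
    (h' : r' * r = 1) (hv : IsUnit (1 - r' * v * r)) : IsUnit (1 - v) := by
  have hr : IsUnit r := ⟨⟨r, r', h, h'⟩, rfl⟩
  have hr' : IsUnit r' := ⟨⟨r', r, h', h⟩, rfl⟩
  have : 1 - v = r * (1 - r' * v * r) * r' := by
    calc 1 - v = r * r' - (r * r') * v * (r * r') := by rw [h]; simp
      _ = _ := by noncomm_ring
  rw [this]
  exact (hr.mul hv).mul hr'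

/-- The operator need not be a contraction, but it becomes one of norm at most 1/2 after conjugation
by the weight ρ = exp(k ∫|p|) (Bielecki's trick). -/
theorem isUnit_one_sub_volterra (hℓ : 0 < ℓ) (p : Potential ℓ) : IsUnit (1 - volterra p) := by
  set g : ℝ → ℝ := (Icc 0 ℓ).indicator (fun t => |p t|) with hg
  have hgint : Integrable g volume := (integrable_indicator_iff measurableSet_Icc).2 p.integrable.norm
  have hg0 : ∀ t, 0 ≤ g t := fun t => indicator_nonneg (fun _ _ => abs_nonneg _) t
  -- The inner integration costs a factor ℓ and the outer one, against |p| ρ, gains k⁻¹; this choice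
  -- makes the product 1/2.
  set k : ℝ := 2 * ℓ with hk
  have hk0 : 0 < k := by positivity
  have hPle : ∀ x, |k * ∫ s in 0..x, g s| ≤ k * ‖p‖ := by
    intro x
    rw [abs_mul, abs_of_pos hk0]
    gcongr
    refine (intervalIntegral.abs_integral_le_integral_norm_uIoc).trans ?_
    refine (setIntegral_le_integral hgint.norm
      (Filter.Eventually.of_forall fun t => norm_nonneg _)).trans ?_
    rw [← integral_abs_eq_norm, ← integral_indicator measurableSet_Icc]
    simp_rw [Real.norm_of_nonneg (hg0 _)]
    exact le_rfl
  have hPc : Continuous fun x => k * ∫ s in 0..x, g s :=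
    continuous_const.mul (intervalIntegral.continuous_primitive
      (fun _ _ => hgint.intervalIntegrable) 0)
  have hmono : ∀ s t, s ≤ t → k * ∫ s in 0..s, g s ≤ k * ∫ s in 0..t, g s := by
    intro s t hst
    gcongr
    rw [← intervalIntegral.integral_add_adjacent_intervals (b := s)
      (hgint.intervalIntegrable (a := 0)) (hgint.intervalIntegrable (b := t))]
    linarith [intervalIntegral.integral_nonneg_of_forall hst hg0 (μ := volume)]
  let ρ : ℝ →ᵇ ℝ := BoundedContinuousFunction.ofNormedAddCommGroup
    (fun x => Real.exp (k * ∫ s in 0..x, g s)) hPc.rexp (Real.exp (k * ‖p‖)) (fun x => by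
      rw [Real.norm_of_nonneg (Real.exp_pos _).le]
      exact Real.exp_le_exp.2 (le_of_abs_le (hPle x)))
  let σ : ℝ →ᵇ ℝ := BoundedContinuousFunction.ofNormedAddCommGroup
    (fun x => Real.exp (-(k * ∫ s in 0..x, g s))) hPc.neg.rexp (Real.exp (k * ‖p‖)) (fun x => by
      rw [Real.norm_of_nonneg (Real.exp_pos _).le]
      exact Real.exp_le_exp.2 (neg_le.1 (abs_le.1 (hPle x)).1))
  have hρ : ∀ x, ρ x = Real.exp (k * ∫ s in 0..x, g s) := fun _ => rfl
  have hσ : ∀ x, σ x = Real.exp (-(k * ∫ s in 0..x, g s)) := fun _ => rfl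
  have hρσ : ρ * σ = 1 := by
    ext x
    simp [hρ, hσ, ← Real.exp_add]
  have hσρ : σ * ρ = 1 := by rw [mul_comm, hρσ]
  let R : (ℝ →ᵇ ℝ) →L[ℝ] (ℝ →ᵇ ℝ) := ContinuousLinearMap.mul ℝ (ℝ →ᵇ ℝ) ρ
  let R' : (ℝ →ᵇ ℝ) →L[ℝ] (ℝ →ᵇ ℝ) := ContinuousLinearMap.mul ℝ (ℝ →ᵇ ℝ) σ
  have hRR' : R * R' = 1 := by
    ext1 u
    change ρ * (σ * u) = u
    rw [← mul_assoc, hρσ, one_mul]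
  have hR'R : R' * R = 1 := by
    ext1 u
    change σ * (ρ * u) = u
    rw [← mul_assoc, hσρ, one_mul]
  have hInt : ∀ (u : ℝ →ᵇ ℝ) (t : ℝ), 0 ≤ t → |primitive ℓ (ρ * u) t| ≤ ℓ * ‖u‖ * ρ t := by
    intro u t ht
    have h1 : |primitive ℓ (ρ * u) t| ≤
        ∫ s in uIoc 0 t, ‖(ρ * u) s‖ ∂(intervalMeasure ℓ) := by
      rw [primitive_apply]
      exact intervalIntegral.abs_integral_le_integral_norm_uIoc
    have h2 : ∫ s in uIoc 0 t, ‖(ρ * u) s‖ ∂(intervalMeasure ℓ) ≤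
        ∫ s in uIoc 0 t, ρ t * ‖u‖ ∂(intervalMeasure ℓ) := by
      refine setIntegral_mono_on ?_ (integrable_const _) measurableSet_uIoc ?_
      · exact ((BoundedContinuousFunction.integrable (intervalMeasure ℓ) (ρ * u)).norm).integrableOn
      · intro s hs
        rw [uIoc_of_le ht] at hs
        rw [BoundedContinuousFunction.mul_apply, norm_mul, hρ s,
          Real.norm_of_nonneg (Real.exp_pos _).le]
        exact mul_le_mul (Real.exp_le_exp.2 (hmono s t hs.2)) (u.norm_coe_le_norm s)
          (norm_nonneg _) (Real.exp_pos _).le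
    have h3 : ∫ s in uIoc 0 t, ρ t * ‖u‖ ∂(intervalMeasure ℓ) ≤
        ∫ s, ρ t * ‖u‖ ∂(intervalMeasure ℓ) :=
      setIntegral_le_integral (integrable_const _)
        (Filter.Eventually.of_forall fun _ => mul_nonneg (Real.exp_pos _).le (norm_nonneg _))
    have h4 : ∫ s, ρ t * ‖u‖ ∂(intervalMeasure ℓ) = ℓ * (ρ t * ‖u‖) := by
      simp [hℓ.le]
    calc _ ≤ ℓ * (ρ t * ‖u‖) := by linarith
      _ = _ := by ring
  have hbound : ∀ (u : ℝ →ᵇ ℝ) (x : ℝ), |volterra p (ρ * u) x| ≤ 2⁻¹ * ‖u‖ * ρ x := by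
    intro u x
    have hρx : 0 < ρ x := Real.exp_pos _
    change |primitiveMulL ℓ p (primitive ℓ (ρ * u)) x| ≤ _
    rw [primitiveMulL_apply]
    rcases le_total x 0 with hx | hx
    · rw [intervalIntegral_of_nonpos hx, abs_zero]
      positivity
    have h1 : |∫ t in 0..x, p t * primitive ℓ (ρ * u) t ∂(intervalMeasure ℓ)| ≤
        ∫ t in uIoc 0 x, ‖p t * primitive ℓ (ρ * u) t‖ ∂(intervalMeasure ℓ) :=
      intervalIntegral.abs_integral_le_integral_norm_uIoc
    have h2 : ∫ t in uIoc 0 x, ‖p t * primitive ℓ (ρ * u) t‖ ∂(intervalMeasure ℓ) ≤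
        ∫ t in uIoc 0 x, ℓ * ‖u‖ * (|p t| * ρ t) ∂(intervalMeasure ℓ) := by
      refine setIntegral_mono_on (p.integrable_mul _).norm.integrableOn ?_ measurableSet_uIoc ?_
      · refine Integrable.integrableOn (Integrable.const_mul ?_ _)
        exact p.integrable.norm.mul_bdd ρ.continuous.aestronglyMeasurable (c := ‖ρ‖)
          (Filter.Eventually.of_forall fun t => ρ.norm_coe_le_norm t)
      · intro t ht
        rw [uIoc_of_le hx] at ht
        rw [norm_mul, Real.norm_eq_abs, Real.norm_eq_abs]
        calc _ ≤ |p t| * (ℓ * ‖u‖ * ρ t) :=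
              mul_le_mul_of_nonneg_left (hInt u t ht.1.le) (abs_nonneg _)
          _ = _ := by ring
    have h3 : ∫ t in uIoc 0 x, |p t| * ρ t ∂(intervalMeasure ℓ) =
        ∫ t in 0..x, g t * Real.exp (k * ∫ s in 0..t, g s) := by
      rw [intervalIntegral.integral_of_le hx, uIoc_of_le hx,
        Measure.restrict_restrict measurableSet_Ioc, inter_comm,
        ← Measure.restrict_restrict measurableSet_Icc, ← integral_indicator measurableSet_Icc]
      refine integral_congr_ae (Filter.Eventually.of_forall fun t => ?_)
      by_cases ht : t ∈ Icc 0 ℓ <;> simp [hg, ht, hρ]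
    rw [integral_const_mul, h3] at h2
    have h4 := integral_mul_exp_primitive_le hgint hk0 (x := x)
    calc _ ≤ ℓ * ‖u‖ * (∫ t in 0..x, g t * Real.exp (k * ∫ s in 0..t, g s)) := h1.trans h2
      _ ≤ ℓ * ‖u‖ * (k⁻¹ * ρ x) := by gcongr; exact h4
      _ = 2⁻¹ * ‖u‖ * ρ x := by rw [hk]; field_simp
  have hS : ‖R' * volterra p * R‖ ≤ 2⁻¹ := by
    refine ContinuousLinearMap.opNorm_le_bound _ (by norm_num) fun u => ?_
    refine (BoundedContinuousFunction.norm_le (by positivity)).2 fun x => ?_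
    change |σ x * volterra p (ρ * u) x| ≤ _
    have hσx : 0 < σ x := Real.exp_pos _
    rw [abs_mul, abs_of_pos hσx]
    calc _ ≤ σ x * (2⁻¹ * ‖u‖ * ρ x) := by gcongr; exact hbound u x
      _ = 2⁻¹ * ‖u‖ * (ρ * σ) x := by rw [BoundedContinuousFunction.mul_apply]; ring
      _ = _ := by rw [hρσ]; simp
  have hlt : ‖R' * volterra p * R‖ < 1 := hS.trans_lt (by norm_num)
  have hU : IsUnit (1 - R' * volterra p * R) :=
    isUnit_one_sub_of_norm_lt_one (R := (ℝ →ᵇ ℝ) →L[ℝ] (ℝ →ᵇ ℝ)) hlt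
  exact isUnit_one_sub_of_conj (A := (ℝ →ᵇ ℝ) →L[ℝ] (ℝ →ᵇ ℝ)) hRR' hR'R hU

end Potential

/-! ### The initial value problem, smooth dependence on the potential, and shooting -/

namespace Potential

variable {ℓ : ℝ}

/-- The derivative of the solution of `y'' = p y`, `y 0 = 0`, `y' 0 = 1`. -/
noncomputable def solDeriv (p : Potential ℓ) : ℝ →ᵇ ℝ := Ring.inverse (1 - volterra p) 1

/-- The solution of `y'' = p y`, `y 0 = 0`, `y' 0 = 1`, extended by constants outside `[0, ℓ]`. -/
noncomputable def sol (p : Potential ℓ) : ℝ →ᵇ ℝ := primitive ℓ (solDeriv p)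

theorem solDeriv_eq (hℓ : 0 < ℓ) (p : Potential ℓ) :
    solDeriv p = 1 + volterra p (solDeriv p) := by
  have h := Ring.mul_inverse_cancel _ (isUnit_one_sub_volterra hℓ p)
  have h1 : (1 - volterra p) (solDeriv p) = 1 := congrArg (fun f => f 1) h
  exact sub_eq_iff_eq_add.1 h1

/-- Uniqueness for the initial value problem, from injectivity of 1 - V. -/
theorem eq_smul_solDeriv (hℓ : 0 < ℓ) {p : Potential ℓ} {c : ℝ} {w : ℝ →ᵇ ℝ}
    (hw : w = c • 1 + volterra p w) : w = c • solDeriv p := by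
  have h := Ring.inverse_mul_cancel _ (isUnit_one_sub_volterra hℓ p)
  have h1 : (1 - volterra p) w = c • (1 : ℝ →ᵇ ℝ) := sub_eq_iff_eq_add.2 hw
  have h2 : Ring.inverse (1 - volterra p) ((1 - volterra p) w) = w := congrArg (fun f => f w) h
  rw [← h2, h1, map_smul, solDeriv]

/-- The operator 1 - V is affine and continuous in p, and inversion is smooth at units of a Banach
algebra. -/
theorem contDiff_solDeriv (hℓ : 0 < ℓ) {n : ℕ∞} :
    ContDiff ℝ n (solDeriv : Potential ℓ → ℝ →ᵇ ℝ) := by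
  have hv : ContDiff ℝ n (fun p : Potential ℓ => 1 - volterra p) := by
    refine contDiff_const.sub ?_
    have h : ContDiff ℝ n (primitiveMulL ℓ) :=
      ContinuousLinearMap.contDiff (𝕜 := ℝ) (E := Potential ℓ)
        (F := (ℝ →ᵇ ℝ) →L[ℝ] (ℝ →ᵇ ℝ)) (primitiveMulL ℓ)
    exact h.clm_comp contDiff_const
  refine contDiff_iff_contDiffAt.2 fun p => ?_
  obtain ⟨u, hu⟩ := isUnit_one_sub_volterra hℓ p
  have h1 : ContDiffAt ℝ n (fun p : Potential ℓ => Ring.inverse (1 - volterra p)) p := by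
    refine ContDiffAt.comp p (g := Ring.inverse) ?_ hv.contDiffAt
    rw [← hu]
    exact contDiffAt_ringInverse ℝ (R := (ℝ →ᵇ ℝ) →L[ℝ] (ℝ →ᵇ ℝ)) u
  exact h1.clm_apply contDiffAt_const

theorem contDiff_sol (hℓ : 0 < ℓ) {n : ℕ∞} : ContDiff ℝ n (sol : Potential ℓ → ℝ →ᵇ ℝ) :=
  (primitive ℓ).contDiff.comp (contDiff_solDeriv hℓ)

theorem intervalIntegral_eq_indicator {f : ℝ → ℝ} {a b : ℝ} :
    ∫ t in a..b, f t ∂(intervalMeasure ℓ) = ∫ t in a..b, (Icc 0 ℓ).indicator f t := by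
  have key : ∀ a b : ℝ, ∫ t in Ioc a b, f t ∂(intervalMeasure ℓ) =
      ∫ t in Ioc a b, (Icc 0 ℓ).indicator f t := by
    intro a b
    rw [Measure.restrict_restrict measurableSet_Ioc, inter_comm,
      ← Measure.restrict_restrict measurableSet_Icc, ← integral_indicator measurableSet_Icc]
  rw [intervalIntegral, intervalIntegral, key, key]

theorem intervalIntegral_projIcc (hℓ : 0 < ℓ) {f : ℝ → ℝ} (hf : Integrable f (intervalMeasure ℓ))
    (x : ℝ) : ∫ t in 0..(projIcc 0 ℓ hℓ.le x : ℝ), f t ∂(intervalMeasure ℓ) =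
      ∫ t in 0..x, f t ∂(intervalMeasure ℓ) := by
  rcases le_total x 0 with hx | hx
  · rw [projIcc_of_le_left _ hx, intervalIntegral_of_nonpos hx, intervalIntegral.integral_same]
  rcases le_total x ℓ with hx' | hx'
  · rw [projIcc_of_mem _ ⟨hx, hx'⟩]
  · rw [projIcc_of_right_le _ hx', ← intervalIntegral.integral_add_adjacent_intervals (b := ℓ)
      hf.intervalIntegrable (c := x) hf.intervalIntegrable, left_eq_add,
      intervalIntegral.integral_of_le hx', Measure.restrict_restrict measurableSet_Ioc,
      Measure.restrict_eq_zero.2, integral_zero_measure]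
    refine measure_mono_null (t := ∅) ?_ measure_empty
    rintro t ⟨ht, ht'⟩
    exact absurd ht.1 (not_lt.2 ht'.2)

theorem sol_apply (p : Potential ℓ) (x : ℝ) :
    sol p x = ∫ t in 0..x, (Icc 0 ℓ).indicator (solDeriv p) t := by
  rw [sol, primitive_apply, intervalIntegral_eq_indicator]

theorem solDeriv_apply (hℓ : 0 < ℓ) (p : Potential ℓ) (x : ℝ) :
    solDeriv p x = 1 + ∫ t in 0..x, (Icc 0 ℓ).indicator (fun t => p t * sol p t) t := by
  have h := DFunLike.congr_fun (solDeriv_eq hℓ p) x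
  rw [← intervalIntegral_eq_indicator]
  exact h

theorem integrable_indicator_mul (p : Potential ℓ) (u : ℝ →ᵇ ℝ) :
    Integrable ((Icc 0 ℓ).indicator (fun t => p t * u t)) volume :=
  (integrable_indicator_iff measurableSet_Icc).2 (p.integrable_mul u)

@[simp] theorem sol_zero (p : Potential ℓ) : sol p 0 = 0 := by simp [sol_apply]

theorem solDeriv_zero (hℓ : 0 < ℓ) (p : Potential ℓ) : solDeriv p 0 = 1 := by
  simp [solDeriv_apply hℓ]

theorem hasDerivWithinAt_sol (p : Potential ℓ) {x : ℝ} (hx : x ∈ Icc 0 ℓ) :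
    HasDerivWithinAt (sol p) (solDeriv p x) (Icc 0 ℓ) x := by
  have h : HasDerivAt (fun x => ∫ t in 0..x, solDeriv p t) (solDeriv p x) x :=
    (solDeriv p).continuous.integral_hasStrictDerivAt 0 x |>.hasDerivAt
  refine h.hasDerivWithinAt.congr_of_mem (fun t ht => ?_) hx
  rw [sol, primitive_apply, intervalIntegral_restrict (left_mem_Icc.2 (ht.1.trans ht.2)) ht]

theorem hasDerivAt_sol (p : Potential ℓ) {x : ℝ} (hx : x ∈ Ioo 0 ℓ) :
    HasDerivAt (sol p) (solDeriv p x) x :=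
  (hasDerivWithinAt_sol p (Ioo_subset_Icc_self hx)).hasDerivAt (Icc_mem_nhds hx.1 hx.2)

theorem absolutelyContinuousOnInterval_sol (p : Potential ℓ) :
    AbsolutelyContinuousOnInterval (sol p) 0 ℓ := by
  have hi : Integrable ((Icc 0 ℓ).indicator (solDeriv p)) volume :=
    (integrable_indicator_iff measurableSet_Icc).2
      (BoundedContinuousFunction.integrable (intervalMeasure ℓ) _)
  have h := hi.intervalIntegrable.absolutelyContinuousOnInterval_intervalIntegral
    (a := 0) (b := ℓ) (c := 0) (by simp)
  exact (funext (sol_apply p) : ⇑(sol p) = _) ▸ h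

theorem ae_hasDerivAt_solDeriv (hℓ : 0 < ℓ) (p : Potential ℓ) :
    ∀ᵐ x, x ∈ Icc 0 ℓ → HasDerivAt (solDeriv p) (p x * sol p x) x := by
  have hi := (integrable_indicator_mul p (sol p)).intervalIntegrable (a := 0) (b := ℓ)
  filter_upwards [hi.ae_hasDerivAt_integral] with x hx hxI
  have h := (hx (by rwa [uIcc_of_le hℓ.le]) 0 (by simp)).const_add 1
  rw [indicator_of_mem hxI] at h
  exact (funext (solDeriv_apply hℓ p) : ⇑(solDeriv p) = _) ▸ h

theorem absolutelyContinuousOnInterval_solDeriv (hℓ : 0 < ℓ) (p : Potential ℓ) :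
    AbsolutelyContinuousOnInterval (solDeriv p) 0 ℓ := by
  have h := (integrable_indicator_mul p (sol p)).intervalIntegrable (a := 0) (b := ℓ)
    |>.absolutelyContinuousOnInterval_intervalIntegral (c := 0) (by simp)
  have hc : AbsolutelyContinuousOnInterval (fun _ : ℝ => (1 : ℝ)) 0 ℓ :=
    contDiff_const.contDiffOn.absolutelyContinuousOnInterval
  exact (funext (solDeriv_apply hℓ p) : ⇑(solDeriv p) = _) ▸ hc.fun_add h

theorem sub_smul_one_apply (q : Potential ℓ) (lam : ℝ) :
    ∀ᵐ x ∂(intervalMeasure ℓ), (q - lam • one ℓ) x = q x - lam := by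
  filter_upwards [Lp.coeFn_sub q (lam • one ℓ), Lp.coeFn_smul lam (one ℓ), coeFn_one (ℓ := ℓ)]
    with x h1 h2 h3
  rw [h1, Pi.sub_apply, h2, Pi.smul_apply, h3, smul_eq_mul, mul_one]

theorem isSturmLiouvilleSolution_sol (hℓ : 0 < ℓ) (q : Potential ℓ) (lam : ℝ) :
    IsSturmLiouvilleSolution ℓ q lam (sol (q - lam • one ℓ)) (solDeriv (q - lam • one ℓ)) := by
  refine ⟨fun x hx => hasDerivWithinAt_sol _ hx,
    absolutelyContinuousOnInterval_solDeriv hℓ _, ?_⟩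
  filter_upwards [(ae_restrict_iff' measurableSet_Icc).2
    (ae_hasDerivAt_solDeriv hℓ (q - lam • one ℓ)), sub_smul_one_apply q lam] with x hx hx'
  rw [hx.deriv, hx']
  ring

/-- Integrating the equation twice shows that w solves the Volterra equation with initial value
w(0), so uniqueness applies. -/
theorem _root_.IsSturmLiouvilleSolution.eqOn_sol (hℓ : 0 < ℓ) {q : Potential ℓ} {lam : ℝ}
    {z w : ℝ → ℝ} (h : IsSturmLiouvilleSolution ℓ q lam z w) (hz : z 0 = 0) :
    ∀ x ∈ Icc 0 ℓ, z x = w 0 * sol (q - lam • one ℓ) x := by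
  obtain ⟨hzw, hac, hae⟩ := h
  set p := q - lam • one ℓ with hp
  have hwc : ContinuousOn w (Icc 0 ℓ) := by simpa [uIcc_of_le hℓ.le] using hac.continuousOn
  -- Extending w by constants puts it in the space of bounded continuous functions. The Volterra
  -- image is constant outside [0, ℓ] as well, so the fixed-point equation holds on all of ℝ.
  let W : ℝ →ᵇ ℝ := BoundedContinuousFunction.ofNormedAddCommGroup
    (IccExtend hℓ.le (domRestrict (Icc 0 ℓ) w)) (by
      exact (continuousOn_iff_continuous_domRestrict.1 hwc).Icc_extend')
    hac.exists_bound.choose (fun x => by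
      refine hac.exists_bound.choose_spec _ ?_
      rw [uIcc_of_le hℓ.le]
      exact (projIcc 0 ℓ hℓ.le x).2)
  have hW : ∀ x ∈ Icc 0 ℓ, W x = w x := fun x hx =>
    IccExtend_of_mem hℓ.le (domRestrict (Icc 0 ℓ) w) hx
  have hzI : ∀ x ∈ Icc 0 ℓ, z x = primitive ℓ W x := by
    intro x hx
    have hsub : uIcc 0 x ⊆ Icc 0 ℓ := by
      rw [uIcc_of_le hx.1]; exact Icc_subset_Icc_right hx.2
    rw [primitive_apply, intervalIntegral_restrict (left_mem_Icc.2 hℓ.le) hx,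
      intervalIntegral.integral_congr (g := w) fun t ht => hW t (hsub ht)]
    rw [intervalIntegral.integral_eq_sub_of_hasDeriv_right (f := z), hz, sub_zero]
    · exact fun t ht => ((hzw t (hsub ht)).mono hsub).continuousWithinAt
    · intro t ht
      rw [min_eq_left hx.1, max_eq_right hx.1] at ht
      have htI : t ∈ Icc 0 ℓ := ⟨ht.1.le, ht.2.le.trans hx.2⟩
      exact ((hzw t htI).hasDerivAt (Icc_mem_nhds ht.1 (ht.2.trans_le hx.2))).hasDerivWithinAt
    · exact (hwc.mono hsub).intervalIntegrable
  have hwI : ∀ x ∈ Icc 0 ℓ, w x = w 0 + volterra p W x := by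
    intro x hx
    change _ = _ + primitiveMulL ℓ p (primitive ℓ W) x
    have hsub : uIcc 0 x ⊆ Icc 0 ℓ := by
      rw [uIcc_of_le hx.1]; exact Icc_subset_Icc_right hx.2
    have h1 := (hac.mono (c := 0) (d := x) (by rwa [uIcc_of_le hℓ.le])).integral_deriv_eq_sub
    rw [primitiveMulL_apply, intervalIntegral_restrict (left_mem_Icc.2 hℓ.le) hx,
      ← sub_eq_iff_eq_add', ← h1]
    refine intervalIntegral.integral_congr_ae ?_
    filter_upwards [(ae_restrict_iff' measurableSet_Icc).1 hae,
      (ae_restrict_iff' measurableSet_Icc).1 (sub_smul_one_apply q lam)] with t h2 h3 ht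
    have htI := hsub (uIoc_subset_uIcc ht)
    rw [h3 htI, ← hzI t htI]
    linarith [h2 htI]
  have hfix : W = w 0 • 1 + volterra p W := by
    ext x
    have hWx : W x = w (projIcc 0 ℓ hℓ.le x) := rfl
    have hvx : volterra p W x = volterra p W (projIcc 0 ℓ hℓ.le x) :=
      (intervalIntegral_projIcc hℓ (p.integrable_mul _) x).symm
    rw [hWx, hwI _ (projIcc 0 ℓ hℓ.le x).2, BoundedContinuousFunction.add_apply, hvx]
    simp
  intro x hx
  rw [hzI x hx, eq_smul_solDeriv hℓ hfix, map_smul]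
  rfl

theorem isDirichletEigenvalue_iff (hℓ : 0 < ℓ) (q : Potential ℓ) (lam : ℝ) :
    IsDirichletEigenvalue ℓ q lam ↔ sol (q - lam • one ℓ) ℓ = 0 := by
  constructor
  · rintro ⟨z, w, h, hz0, hzℓ, x, hx, hzx⟩
    have key := h.eqOn_sol hℓ hz0
    have h1 := key ℓ (right_mem_Icc.2 hℓ.le)
    rw [hzℓ, eq_comm, mul_eq_zero] at h1
    refine h1.resolve_left fun h0 => hzx ?_
    rw [key x hx, h0, zero_mul]
  · intro h
    refine ⟨_, _, isSturmLiouvilleSolution_sol hℓ q lam, sol_zero _, h, ?_⟩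
    by_contra! hcon
    have hd : HasDerivWithinAt (sol (q - lam • one ℓ)) 0 (Icc 0 ℓ) 0 :=
      (hasDerivWithinAt_const 0 _ (0 : ℝ)).congr (fun x hx => hcon x hx) (sol_zero _)
    have h1 := (uniqueDiffOn_Icc hℓ 0 (left_mem_Icc.2 hℓ.le)).eq_deriv _ hd
      (hasDerivWithinAt_sol _ (left_mem_Icc.2 hℓ.le))
    rw [solDeriv_zero hℓ] at h1
    exact zero_ne_one h1

end Potential

/-! ### Comparison theory: Wronskian, Picone's identity, disconjugacy -/

theorem AbsolutelyContinuousOnInterval.inv_of_pos {f : ℝ → ℝ} {a b : ℝ}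
    (hf : AbsolutelyContinuousOnInterval f a b) (hpos : ∀ x ∈ uIcc a b, 0 < f x) :
    AbsolutelyContinuousOnInterval (fun x => (f x)⁻¹) a b := by
  obtain ⟨x₀, hx₀, hmin⟩ := isCompact_uIcc.exists_isMinOn nonempty_uIcc hf.continuousOn
  obtain ⟨x₁, hx₁, hmax⟩ := isCompact_uIcc.exists_isMaxOn nonempty_uIcc hf.continuousOn
  have hd : ContDiffOn ℝ 1 (fun x : ℝ => x⁻¹) (Icc (f x₀) (f x₁)) :=
    contDiffOn_id.inv fun x hx => ((hpos x₀ hx₀).trans_le hx.1).ne'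
  obtain ⟨K, hK⟩ := hd.exists_lipschitzOnWith (by decide) (convex_Icc _ _) isCompact_Icc
  exact hK.comp_absolutelyContinuousOnInterval hf fun x hx => ⟨hmin hx, hmax hx⟩

namespace Potential

open Filter Topology

variable {ℓ : ℝ}

theorem uIcc_subset_of_mem {a b : ℝ} (ha : a ∈ Icc 0 ℓ) (hb : b ∈ Icc 0 ℓ) :
    uIcc a b ⊆ uIcc 0 ℓ := by
  rw [uIcc_of_le (ha.1.trans ha.2)]
  exact uIcc_subset_Icc ha hb

theorem ae_hasDerivAt_sol_solDeriv (hℓ : 0 < ℓ) (p : Potential ℓ) :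
    ∀ᵐ x, x ∈ Icc 0 ℓ → HasDerivAt (sol p) (solDeriv p x) x ∧
      HasDerivAt (solDeriv p) (p x * sol p x) x := by
  have h0 : ∀ᵐ x : ℝ, x ≠ 0 := by simp [ae_iff, measure_singleton]
  have h1 : ∀ᵐ x : ℝ, x ≠ ℓ := by simp [ae_iff, measure_singleton]
  filter_upwards [h0, h1, ae_hasDerivAt_solDeriv hℓ p] with x hx0 hxℓ hx hxI
  exact ⟨hasDerivAt_sol p ⟨hxI.1.lt_of_ne' hx0, hxI.2.lt_of_ne hxℓ⟩, hx hxI⟩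

theorem intervalIntegrable_of_mem {f : ℝ → ℝ} (hf : Integrable f (intervalMeasure ℓ)) {a b : ℝ}
    (ha : a ∈ Icc 0 ℓ) (hb : b ∈ Icc 0 ℓ) : IntervalIntegrable f volume a b := by
  have : IntegrableOn f (Icc 0 ℓ) := hf
  exact (intervalIntegrable_iff_integrableOn_Icc_of_le (ha.1.trans ha.2)).2 this
    |>.mono_set (uIcc_subset_of_mem ha hb)

theorem wronskian_eq (hℓ : 0 < ℓ) (p q : Potential ℓ) {c : ℝ} (hc : c ∈ Icc 0 ℓ) :
    sol p c * solDeriv q c - solDeriv p c * sol q c =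
      ∫ t in 0..c, (q t - p t) * (sol p t * sol q t) := by
  have h0 : (0 : ℝ) ∈ Icc 0 ℓ := left_mem_Icc.2 hℓ.le
  have hsub := uIcc_subset_of_mem h0 hc
  have hac := ((absolutelyContinuousOnInterval_sol p).fun_mul
    (absolutelyContinuousOnInterval_solDeriv hℓ q)).fun_sub
    ((absolutelyContinuousOnInterval_solDeriv hℓ p).fun_mul
    (absolutelyContinuousOnInterval_sol q)) |>.mono hsub
  have h := hac.integral_deriv_eq_sub
  rw [sol_zero, sol_zero, zero_mul, mul_zero, sub_zero, sub_zero] at h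
  rw [← h]
  refine intervalIntegral.integral_congr_ae ?_
  filter_upwards [ae_hasDerivAt_sol_solDeriv hℓ p, ae_hasDerivAt_sol_solDeriv hℓ q]
    with x hp hq hx
  have hxI : x ∈ Icc 0 ℓ := by
    rw [← uIcc_of_le hℓ.le]
    exact hsub (uIoc_subset_uIcc hx)
  obtain ⟨hp1, hp2⟩ := hp hxI
  obtain ⟨hq1, hq2⟩ := hq hxI
  rw [((hp1.fun_mul hq2).fun_sub (hp2.fun_mul hq1)).deriv]
  ring

theorem tendsto_sol_div (hℓ : 0 < ℓ) (p : Potential ℓ) :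
    Tendsto (fun x => sol p x / x) (𝓝[>] 0) (𝓝 1) := by
  have h := hasDerivWithinAt_sol p (left_mem_Icc.2 hℓ.le)
  rw [solDeriv_zero hℓ] at h
  have h' : HasDerivWithinAt (sol p) 1 (Ioi 0) 0 :=
    (h.mono Ioo_subset_Icc_self).mono_of_mem_nhdsWithin (Ioo_mem_nhdsGT hℓ)
  rw [hasDerivWithinAt_iff_tendsto_slope' (by simp)] at h'
  refine h'.congr fun x => ?_
  simp [slope_def_field]

theorem eventually_sol_pos (hℓ : 0 < ℓ) (p : Potential ℓ) : ∀ᶠ x in 𝓝[>] 0, 0 < sol p x := by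
  filter_upwards [(tendsto_sol_div hℓ p).eventually (lt_mem_nhds one_pos), self_mem_nhdsWithin]
    with x hx hx0
  exact (div_pos_iff_of_pos_right hx0).1 hx

/-- The solution of the initial value problem is positive on `(0, ℓ]`. -/
def IsDisconjugate (p : Potential ℓ) : Prop := ∀ x ∈ Ioc 0 ℓ, 0 < sol p x

theorem isDisconjugate_of_ne_zero (hℓ : 0 < ℓ) {p : Potential ℓ}
    (h : ∀ x ∈ Ioc 0 ℓ, sol p x ≠ 0) : IsDisconjugate p := by
  intro x hx
  by_contra! hneg
  obtain ⟨δ, hδ, hδx⟩ := ((eventually_sol_pos hℓ p).and (Ioo_mem_nhdsGT hx.1)).exists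
  obtain ⟨c, hc, hc0⟩ := intermediate_value_Icc' hδx.2.le (sol p).continuous.continuousOn
    ⟨hneg, hδ.le⟩
  exact h c ⟨hδx.1.trans_le hc.1, hc.2.trans hx.2⟩ hc0

/-- Both solutions are asymptotic to x at 0, so y/y₀ tends to 1 and the factor y that remains tends
to 0. -/
theorem tendsto_jacobi_zero (hℓ : 0 < ℓ) (p p₀ : Potential ℓ) :
    Tendsto (fun x => sol p x * solDeriv p x - sol p x * sol p x * (sol p₀ x)⁻¹ * solDeriv p₀ x)
      (𝓝[>] 0) (𝓝 0) := by
  have hc : ∀ f : ℝ →ᵇ ℝ, Tendsto f (𝓝[>] 0) (𝓝 (f 0)) := fun f =>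
    f.continuous.continuousAt.mono_left nhdsWithin_le_nhds
  have h1 := (hc (sol p)).mul (hc (solDeriv p))
  have h2 := (((hc (sol p)).mul ((tendsto_sol_div hℓ p).div (tendsto_sol_div hℓ p₀) one_ne_zero)).mul
    (hc (solDeriv p₀)))
  have h3 := h1.sub h2
  simp only [sol_zero, zero_mul, sub_zero] at h3
  refine h3.congr' ?_
  filter_upwards [self_mem_nhdsWithin, eventually_sol_pos hℓ p₀] with x hx hx'
  have hx0 : x ≠ 0 := (mem_Ioi.1 hx).ne'
  simp only [Pi.div_apply]
  field_simp

/-- Picone's identity: y y' - y² y₀'/y₀ has derivative (y' - y y₀'/y₀)² + (p - p₀) y². The integral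
starts at a > 0 because y₀(0) = 0. -/
theorem jacobi_identity (hℓ : 0 < ℓ) (p p₀ : Potential ℓ) {a c : ℝ} (ha : 0 < a) (hac : a ≤ c)
    (hc : c ≤ ℓ) (hpos : ∀ x ∈ Ioc 0 c, 0 < sol p₀ x) (hpc : sol p c = 0) :
    ∫ t in a..c, (solDeriv p t - sol p t * (sol p₀ t)⁻¹ * solDeriv p₀ t) ^ 2 =
      -(sol p a * solDeriv p a - sol p a * sol p a * (sol p₀ a)⁻¹ * solDeriv p₀ a) -
      ∫ t in a..c, (p t - p₀ t) * (sol p t) ^ 2 := by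
  have hsub := uIcc_subset_of_mem (ℓ := ℓ) ⟨ha.le, hac.trans hc⟩ ⟨ha.le.trans hac, hc⟩
  have hposI : ∀ x ∈ uIcc a c, 0 < sol p₀ x := by
    intro x hx
    rw [uIcc_of_le hac] at hx
    exact hpos x ⟨ha.trans_le hx.1, hx.2⟩
  have hy := (absolutelyContinuousOnInterval_sol p).mono hsub
  have hw := (absolutelyContinuousOnInterval_solDeriv hℓ p).mono hsub
  have hy₀ := (absolutelyContinuousOnInterval_sol p₀).mono hsub
  have hw₀ := (absolutelyContinuousOnInterval_solDeriv hℓ p₀).mono hsub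
  have hF := (hy.fun_mul hw).fun_sub
    (((hy.fun_mul hy).fun_mul (hy₀.inv_of_pos hposI)).fun_mul hw₀)
  have h := hF.integral_deriv_eq_sub
  rw [hpc] at h
  have hi1 : IntervalIntegrable
      (fun t => (solDeriv p t - sol p t * (sol p₀ t)⁻¹ * solDeriv p₀ t) ^ 2) volume a c :=
    (((hw.continuousOn.sub ((hy.continuousOn.mul (hy₀.inv_of_pos hposI).continuousOn).mul
      hw₀.continuousOn))).pow 2).intervalIntegrable
  have hi2 : IntervalIntegrable (fun t => (p t - p₀ t) * (sol p t) ^ 2) volume a c := by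
    have hi := intervalIntegrable_of_mem (p.integrable.sub p₀.integrable)
      (a := a) (b := c) ⟨ha.le, hac.trans hc⟩ ⟨ha.le.trans hac, hc⟩
    exact hi.mul_continuousOn (hy.continuousOn.pow 2)
  have h2 : ∫ t in a..c, ((solDeriv p t - sol p t * (sol p₀ t)⁻¹ * solDeriv p₀ t) ^ 2 +
      (p t - p₀ t) * (sol p t) ^ 2) = ∫ t in a..c, deriv (fun x => sol p x * solDeriv p x -
        sol p x * sol p x * (sol p₀ x)⁻¹ * solDeriv p₀ x) t := by
    refine intervalIntegral.integral_congr_ae ?_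
    filter_upwards [ae_hasDerivAt_sol_solDeriv hℓ p, ae_hasDerivAt_sol_solDeriv hℓ p₀]
      with x hp hq hx
    have hx' := uIoc_subset_uIcc hx
    have hxI : x ∈ Icc 0 ℓ := by
      rw [← uIcc_of_le hℓ.le]
      exact hsub hx'
    obtain ⟨hp1, hp2⟩ := hp hxI
    obtain ⟨hq1, hq2⟩ := hq hxI
    have hne := (hposI x hx').ne'
    rw [((hp1.fun_mul hp2).fun_sub (((hp1.fun_mul hp1).fun_mul (hq1.fun_inv hne)).fun_mul hq2)).deriv]
    field_simp
    ring
  rw [intervalIntegral.integral_add hi1 hi2, h] at h2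
  linarith

/-- Letting a tend to 0 in Picone's identity gives the weak inequality. If it were not strict, the
square would vanish, y/y₀ would be constant and hence zero (its value at c), contradicting y > 0
near 0. -/
theorem integral_sub_mul_sq_neg (hℓ : 0 < ℓ) {p p₀ : Potential ℓ} {c : ℝ} (hc : c ∈ Ioc 0 ℓ)
    (hpos : ∀ x ∈ Ioc 0 c, 0 < sol p₀ x) (hpc : sol p c = 0) :
    ∫ t in 0..c, (p t - p₀ t) * (sol p t) ^ 2 < 0 := by
  by_contra! hnonneg
  set h : ℝ → ℝ := fun t => (solDeriv p t - sol p t * (sol p₀ t)⁻¹ * solDeriv p₀ t) ^ 2 with hh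
  have hcI : c ∈ Icc 0 ℓ := Ioc_subset_Icc_self hc
  have hint := intervalIntegrable_of_mem (p.integrable.sub p₀.integrable)
      (left_mem_Icc.2 hℓ.le) hcI |>.mul_continuousOn ((sol p).continuous.pow 2).continuousOn
  have hcont : ∀ a, 0 < a → ContinuousOn h (Icc a c) := fun a ha =>
    ((solDeriv p).continuous.continuousOn.sub (((sol p).continuous.continuousOn.mul
      ((sol p₀).continuous.continuousOn.inv₀ fun x hx =>
        (hpos x ⟨ha.trans_le hx.1, hx.2⟩).ne')).mul (solDeriv p₀).continuous.continuousOn)).pow 2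
  have htail : Tendsto (fun a => ∫ t in a..c, (p t - p₀ t) * (sol p t) ^ 2) (𝓝[>] 0)
      (𝓝 (∫ t in 0..c, (p t - p₀ t) * (sol p t) ^ 2)) := by
    have h1 := intervalIntegral.continuousOn_primitive_interval_left
      ((intervalIntegrable_iff' enorm_ne_top).1 hint) 0 left_mem_uIcc
    rw [uIcc_of_le hc.1.le] at h1
    exact h1.mono_of_mem_nhdsWithin (Icc_mem_nhdsGT hc.1)
  have hzero : ∀ b ∈ Ioo 0 c, sol p b = 0 := by
    intro b hb
    have hle : ∫ t in b..c, h t ≤ 0 := by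
      have hlim := ((tendsto_jacobi_zero hℓ p p₀).neg.sub htail)
      rw [neg_zero, zero_sub] at hlim
      refine le_trans (ge_of_tendsto hlim ?_) (neg_nonpos.2 hnonneg)
      filter_upwards [Ioo_mem_nhdsGT hb.1] with a ha
      have hac := (ha.2.trans hb.2).le
      rw [← jacobi_identity hℓ p p₀ ha.1 hac hc.2 hpos hpc]
      refine intervalIntegral.integral_mono_interval ha.2.le hb.2.le le_rfl
        (Eventually.of_forall fun t => sq_nonneg _) ?_
      exact (hcont a ha.1).intervalIntegrable_of_Icc hac
    have hh0 : ∀ t ∈ Icc b c, h t = 0 := by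
      intro t ht
      by_contra hne
      exact absurd hle (not_le.2 (intervalIntegral.integral_pos hb.2 (hcont b hb.1)
        (fun x _ => sq_nonneg _) ⟨t, ht, (sq_nonneg _).lt_of_ne' hne⟩))
    have hconst := constant_of_has_deriv_right_zero (f := fun x => sol p x * (sol p₀ x)⁻¹)
      (a := b) (b := c) ((sol p).continuous.continuousOn.mul
      ((sol p₀).continuous.continuousOn.inv₀ fun x hx =>
        (hpos x ⟨hb.1.trans_le hx.1, hx.2⟩).ne')) (by
        intro x hx
        have hxI : x ∈ Ioo 0 ℓ := ⟨hb.1.trans_le hx.1, hx.2.trans_le hc.2⟩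
        have hne := (hpos x ⟨hxI.1, hx.2.le⟩).ne'
        have hd := (hasDerivAt_sol p hxI).fun_mul ((hasDerivAt_sol p₀ hxI).fun_inv hne)
        have h0 := pow_eq_zero_iff two_ne_zero |>.1 (hh0 x ⟨hx.1, hx.2.le⟩)
        convert hd.hasDerivWithinAt using 1
        rw [sub_eq_zero.1 h0]
        field_simp
        ring)
    have h1 := hconst c (right_mem_Icc.2 hb.2.le)
    simp only [hpc, zero_mul] at h1
    exact (mul_eq_zero.1 h1.symm).resolve_right (inv_ne_zero (hpos b ⟨hb.1, hb.2.le⟩).ne')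
  obtain ⟨x, hx, hx'⟩ := ((eventually_sol_pos hℓ p).and (Ioo_mem_nhdsGT hc.1)).exists
  exact hx.ne' (hzero x hx')

/-- At a zero c of y, averaging the strict inequalities for p₀ and p₁ makes ∫₀ᶜ (p - (a p₀ + b p₁))
y² negative, although its integrand is nonnegative. -/
theorem IsDisconjugate.of_convexCombination_le (hℓ : 0 < ℓ) {p₀ p₁ p : Potential ℓ}
    (h₀ : IsDisconjugate p₀) (h₁ : IsDisconjugate p₁) {a b : ℝ} (ha : 0 ≤ a) (hb : 0 ≤ b)
    (hab : a + b = 1) (hp : ∀ᵐ x ∂(intervalMeasure ℓ), a * p₀ x + b * p₁ x ≤ p x) :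
    IsDisconjugate p := by
  refine isDisconjugate_of_ne_zero hℓ fun c hc hpc => ?_
  have hcI : c ∈ Icc 0 ℓ := Ioc_subset_Icc_self hc
  have k₀ := integral_sub_mul_sq_neg hℓ hc (fun x hx => h₀ x ⟨hx.1, hx.2.trans hc.2⟩) hpc
  have k₁ := integral_sub_mul_sq_neg hℓ hc (fun x hx => h₁ x ⟨hx.1, hx.2.trans hc.2⟩) hpc
  have hint : ∀ p₀ : Potential ℓ,
      IntervalIntegrable (fun t => (p t - p₀ t) * (sol p t) ^ 2) volume 0 c := fun p₀ =>
    intervalIntegrable_of_mem (p.integrable.sub p₀.integrable)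
      (left_mem_Icc.2 hℓ.le) hcI |>.mul_continuousOn ((sol p).continuous.pow 2).continuousOn
  have hsum : a * (∫ t in 0..c, (p t - p₀ t) * (sol p t) ^ 2) +
      b * (∫ t in 0..c, (p t - p₁ t) * (sol p t) ^ 2) =
      ∫ t in 0..c, (p t - (a * p₀ t + b * p₁ t)) * (sol p t) ^ 2 := by
    rw [← intervalIntegral.integral_const_mul, ← intervalIntegral.integral_const_mul,
      ← intervalIntegral.integral_add ((hint _).const_mul a) ((hint _).const_mul b)]
    refine intervalIntegral.integral_congr fun t _ => ?_
    linear_combination p t * (sol p t) ^ 2 * hab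
  have hnn : 0 ≤ ∫ t in 0..c, (p t - (a * p₀ t + b * p₁ t)) * (sol p t) ^ 2 := by
    refine intervalIntegral.integral_nonneg_of_ae_restrict hc.1.le ?_
    filter_upwards [ae_restrict_of_ae_restrict_of_subset (Icc_subset_Icc_right hc.2) hp] with t ht
    exact mul_nonneg (sub_nonneg.2 ht) (sq_nonneg _)
  rcases ha.eq_or_lt with rfl | ha
  · rw [zero_add] at hab
    subst hab
    linarith
  · nlinarith [mul_neg_of_pos_of_neg ha k₀, mul_nonpos_of_nonneg_of_nonpos hb k₁.le]

/-- The Wronskian of p and p - t at c gives y'(c) y_t(c) = t ∫ y y_t, where y_t is the solution for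
p - t; divide by t and use continuity of y_t in t. -/
theorem hasDerivAt_solDeriv_mul_sol (hℓ : 0 < ℓ) {p : Potential ℓ} {c : ℝ} (hc : c ∈ Ioc 0 ℓ)
    (hpc : sol p c = 0) :
    HasDerivAt (fun t : ℝ => solDeriv p c * sol (p - t • one ℓ) c)
      (∫ t in 0..c, sol p t * sol p t) 0 := by
  have h0 : (0 : ℝ) ∈ Icc 0 ℓ := left_mem_Icc.2 hℓ.le
  have hcI : c ∈ Icc 0 ℓ := Ioc_subset_Icc_self hc
  set m : ℝ → ℝ := fun t => primitive ℓ (sol p * sol (p - t • one ℓ)) c with hm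
  have hm' : ∀ t, m t = ∫ s in 0..c, sol p s * sol (p - t • one ℓ) s := by
    intro t
    rw [hm]
    simp only
    rw [primitive_apply, intervalIntegral_restrict h0 hcI]
    rfl
  have hmc : Continuous m := by
    have h1 : Continuous (sol : Potential ℓ → ℝ →ᵇ ℝ) := (contDiff_sol hℓ (n := 0)).continuous
    have h2 : Continuous fun t : ℝ => primitive ℓ (sol p * sol (p - t • one ℓ)) := by fun_prop
    exact (BoundedContinuousFunction.evalCLM ℝ c).continuous.comp h2
  have key : ∀ t : ℝ, solDeriv p c * sol (p - t • one ℓ) c = t * m t := by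
    intro t
    have h := wronskian_eq hℓ p (p - t • one ℓ) hcI
    rw [hpc, zero_mul, zero_sub, neg_eq_iff_eq_neg] at h
    rw [h, hm', ← intervalIntegral.integral_const_mul, ← intervalIntegral.integral_neg]
    refine intervalIntegral.integral_congr_ae ?_
    filter_upwards [(ae_restrict_iff' measurableSet_Icc).1 (sub_smul_one_apply p t)] with s hs hsc
    have hsI : s ∈ Icc 0 ℓ := by
      rw [← uIcc_of_le hℓ.le]
      exact uIcc_subset_of_mem h0 hcI (uIoc_subset_uIcc hsc)
    rw [hs hsI]
    ring
  have hm0 : m 0 = ∫ t in 0..c, sol p t * sol p t := by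
    rw [hm', zero_smul, sub_zero]
  rw [← hm0, funext key, hasDerivAt_iff_tendsto_slope]
  refine (hmc.continuousAt.tendsto.mono_left nhdsWithin_le_nhds).congr' ?_
  filter_upwards [self_mem_nhdsWithin] with t ht
  have ht0 : t ≠ 0 := ht
  rw [slope_def_field]
  field_simp
  ring

theorem integral_sol_mul_sol_pos (hℓ : 0 < ℓ) (p : Potential ℓ) {c : ℝ} (hc : c ∈ Ioc 0 ℓ) :
    0 < ∫ t in 0..c, sol p t * sol p t := by
  obtain ⟨x, hx, hx'⟩ := ((eventually_sol_pos hℓ p).and (Ioo_mem_nhdsGT hc.1)).exists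
  exact intervalIntegral.integral_pos hc.1 (by fun_prop) (fun t _ => mul_self_nonneg _)
    ⟨x, Ioo_subset_Icc_self hx', mul_pos hx hx⟩

theorem solDeriv_ne_zero (hℓ : 0 < ℓ) {p : Potential ℓ} {c : ℝ} (hc : c ∈ Ioc 0 ℓ)
    (hpc : sol p c = 0) : solDeriv p c ≠ 0 := by
  intro h0
  have h := hasDerivAt_solDeriv_mul_sol hℓ hc hpc
  simp only [h0, zero_mul] at h
  exact (integral_sol_mul_sol_pos hℓ p hc).ne (h.unique (hasDerivAt_const _ _)).symm

theorem isOpen_isDisconjugate (hℓ : 0 < ℓ) : IsOpen {p : Potential ℓ | IsDisconjugate p} := by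
  rw [isOpen_iff_eventually]
  intro p hp
  have h0 : (0 : ℝ) ∈ Icc 0 ℓ := left_mem_Icc.2 hℓ.le
  -- No uniform lower bound on the solution exists near 0, where it vanishes. There positivity comes
  -- from integrating a slope that stays positive under perturbation; away from 0 it comes from a
  -- positive minimum.
  have hw : ∀ᶠ x in 𝓝 (0 : ℝ), 1 / 2 < solDeriv p x :=
    (solDeriv p).continuous.continuousAt.eventually (lt_mem_nhds (by
      rw [solDeriv_zero hℓ]; norm_num))
  obtain ⟨ε, hε, hεw⟩ := Metric.eventually_nhds_iff.1 hw
  set δ := min (ε / 2) ℓ with hδ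
  have hδ0 : 0 < δ := lt_min (half_pos hε) hℓ
  obtain ⟨x₀, hx₀, hmin⟩ := isCompact_Icc.exists_isMinOn
    (nonempty_Icc.2 (min_le_right (ε / 2) ℓ)) (sol p).continuous.continuousOn
  have hm : 0 < sol p x₀ := hp x₀ ⟨hδ0.trans_le hx₀.1, hx₀.2⟩
  have hc1 : Continuous (solDeriv : Potential ℓ → ℝ →ᵇ ℝ) :=
    (contDiff_solDeriv hℓ (n := 0)).continuous
  have hc2 : Continuous (sol : Potential ℓ → ℝ →ᵇ ℝ) := (contDiff_sol hℓ (n := 0)).continuous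
  filter_upwards [hc1.continuousAt.eventually (Metric.ball_mem_nhds _ (half_pos one_pos)),
    hc2.continuousAt.eventually (Metric.ball_mem_nhds _ hm)] with p' h1 h2 x hx
  rcases le_total δ x with hxδ | hxδ
  · have h3 : sol p x₀ ≤ sol p x := hmin ⟨hxδ, hx.2⟩
    have h4 := (BoundedContinuousFunction.dist_coe_le_dist x).trans_lt (Metric.mem_ball.1 h2)
    rw [Real.dist_eq, abs_lt] at h4
    linarith
  · rw [sol, primitive_apply, intervalIntegral_restrict h0 (Ioc_subset_Icc_self hx)]
    refine intervalIntegral.intervalIntegral_pos_of_pos_on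
      ((solDeriv p').continuous.intervalIntegrable _ _) (fun t ht => ?_) hx.1
    have h4 := (BoundedContinuousFunction.dist_coe_le_dist t).trans_lt (Metric.mem_ball.1 h1)
    have h5 := hεw (y := t) (by
      rw [Real.dist_eq, sub_zero, abs_of_pos ht.1]
      linarith [ht.2, min_le_left (ε / 2) ℓ])
    rw [Real.dist_eq, abs_lt] at h4
    linarith

end Potential

/-! ### Existence and concavity of the first eigenvalue -/

namespace Potential

open Filter Topology

variable {ℓ : ℝ}

theorem isDisconjugate_zero (hℓ : 0 < ℓ) : IsDisconjugate (0 : Potential ℓ) := by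
  intro x hx
  have hv : volterra (0 : Potential ℓ) = 0 := by rw [volterra, map_zero, ContinuousLinearMap.zero_comp]
  have hw : solDeriv (0 : Potential ℓ) = 1 := by
    rw [solDeriv_eq hℓ, hv]
    simp
  rw [sol, hw, primitive_apply, intervalIntegral_restrict (left_mem_Icc.2 hℓ.le)
    (Ioc_subset_Icc_self hx)]
  simpa using hx.1

theorem IsDisconjugate.sub_smul_one_of_le (hℓ : 0 < ℓ) {q : Potential ℓ} {lam mu : ℝ}
    (h : IsDisconjugate (q - lam • one ℓ)) (hle : mu ≤ lam) : IsDisconjugate (q - mu • one ℓ) := by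
  refine h.of_convexCombination_le hℓ h (a := 1) (b := 0) zero_le_one le_rfl (add_zero _) ?_
  filter_upwards [sub_smul_one_apply q lam, sub_smul_one_apply q mu] with x h1 h2
  rw [h1, h2]
  linarith

/-- Since q may be unbounded below, choose a bounded continuous g so close to q in L¹ that q - g
lies in the open set of disconjugate potentials around 0. Then q + ‖g‖ ≥ q - g. -/
theorem exists_isDisconjugate_sub_smul_one (hℓ : 0 < ℓ) (q : Potential ℓ) :
    ∃ lam : ℝ, IsDisconjugate (q - lam • one ℓ) := by
  have hd := BoundedContinuousFunction.toLp_denseRange (α := ℝ) ℝ (intervalMeasure ℓ) ℝ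
    (p := 1) ENNReal.one_ne_top
  obtain ⟨g, hg⟩ := hd.exists_mem_open
    ((isOpen_isDisconjugate hℓ).preimage (continuous_const.sub continuous_id : Continuous
      fun x : Potential ℓ => q - x)) ⟨q, by
        change IsDisconjugate (q - q)
        rw [sub_self]
        exact isDisconjugate_zero hℓ⟩
  refine ⟨-‖g‖, ?_⟩
  have hg' : IsDisconjugate (q - BoundedContinuousFunction.toLp 1 (intervalMeasure ℓ) ℝ g) := hg
  refine hg'.of_convexCombination_le hℓ hg' (a := 1) (b := 0) zero_le_one le_rfl (add_zero _) ?_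
  filter_upwards [sub_smul_one_apply q (-‖g‖),
    Lp.coeFn_sub q (BoundedContinuousFunction.toLp 1 (intervalMeasure ℓ) ℝ g),
    BoundedContinuousFunction.coeFn_toLp 1 (intervalMeasure ℓ) ℝ g] with x h1 h2 h3
  rw [h1, h2, Pi.sub_apply, h3]
  linarith [(abs_le.1 (g.norm_coe_le_norm x)).1]

theorem isDirichletEigenvalue_zero_potential (hℓ : 0 < ℓ) :
    IsDirichletEigenvalue ℓ 0 ((Real.pi / ℓ) ^ 2) := by
  set k := Real.pi / ℓ with hk
  have hd : ∀ x, HasDerivAt (fun x => Real.sin (k * x)) (k * Real.cos (k * x)) x := fun x => by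
    simpa [mul_comm] using ((hasDerivAt_id x).const_mul k).sin
  have hd' : ∀ x, HasDerivAt (fun x => k * Real.cos (k * x)) (-(k ^ 2 * Real.sin (k * x))) x :=
    fun x => by
      have h := (((hasDerivAt_id x).const_mul k).cos).const_mul k
      have he : k * (-Real.sin (k * id x) * (k * 1)) = -(k ^ 2 * Real.sin (k * x)) := by
        rw [id]
        ring
      exact he ▸ h
  refine ⟨fun x => Real.sin (k * x), fun x => k * Real.cos (k * x),
    ⟨fun x _ => (hd x).hasDerivWithinAt, ?_, ?_⟩, by simp, ?_, ℓ / 2, ⟨by positivity, by linarith⟩, ?_⟩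
  · exact ContDiffOn.absolutelyContinuousOnInterval (by fun_prop)
  · filter_upwards [Lp.coeFn_zero ℝ 1 (intervalMeasure ℓ)] with x hx
    rw [(hd' x).deriv, hx]
    simp
  · simp only [hk, div_mul_cancel₀ _ hℓ.ne', Real.sin_pi]
  · have : k * (ℓ / 2) = Real.pi / 2 := by rw [hk]; field_simp
    simp [this]

theorem exists_not_isDisconjugate (hℓ : 0 < ℓ) : ∃ p : Potential ℓ, ¬ IsDisconjugate p :=
  ⟨_, fun h => (h ℓ (right_mem_Ioc.2 hℓ)).ne'
    ((isDirichletEigenvalue_iff hℓ _ _).1 (isDirichletEigenvalue_zero_potential hℓ))⟩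

theorem bddAbove_isDisconjugate (hℓ : 0 < ℓ) (q : Potential ℓ) :
    BddAbove {lam : ℝ | IsDisconjugate (q - lam • one ℓ)} := by
  by_contra hunb
  obtain ⟨p, hp⟩ := exists_not_isDisconjugate hℓ
  -- Any p is the midpoint of q + μ and 2p - q - μ. The second is disconjugate for a suitable μ, and
  -- the first would be too if the set were unbounded above.
  obtain ⟨mu, hmu⟩ := exists_isDisconjugate_sub_smul_one hℓ ((2 : ℝ) • p - q)
  obtain ⟨lam, hlam, hle⟩ := not_bddAbove_iff.1 hunb (-mu)
  have hq := IsDisconjugate.sub_smul_one_of_le hℓ hlam hle.le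
  refine hp (hq.of_convexCombination_le hℓ hmu (a := 1 / 2) (b := 1 / 2) (by norm_num)
    (by norm_num) (by norm_num) ?_)
  filter_upwards [sub_smul_one_apply q (-mu), sub_smul_one_apply ((2 : ℝ) • p - q) mu,
    Lp.coeFn_sub ((2 : ℝ) • p) q, Lp.coeFn_smul (2 : ℝ) p] with x h1 h2 h3 h4
  rw [h1, h2, h3, Pi.sub_apply, h4, Pi.smul_apply, smul_eq_mul]
  linarith

theorem continuous_sol_apply (hℓ : 0 < ℓ) (c : ℝ) : Continuous fun p : Potential ℓ => sol p c :=
  (BoundedContinuousFunction.evalCLM ℝ c).continuous.comp (contDiff_sol hℓ (n := 0)).continuous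

/-- At the supremum of the open set of disconjugate shifts the solution has a zero c in (0, ℓ]. If c
< ℓ, the solution is nonnegative near c as a limit of positive ones, so its slope at c is 0, which
`solDeriv_ne_zero` excludes. -/
theorem exists_first_eigenvalue (hℓ : 0 < ℓ) (q : Potential ℓ) :
    ∃ lam : ℝ, sol (q - lam • one ℓ) ℓ = 0 ∧
      ∀ mu < lam, IsDisconjugate (q - mu • one ℓ) := by
  set S := {lam : ℝ | IsDisconjugate (q - lam • one ℓ)} with hS
  have hne : S.Nonempty := exists_isDisconjugate_sub_smul_one hℓ q
  have hbdd : BddAbove S := bddAbove_isDisconjugate hℓ q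
  have hopen : IsOpen S := (isOpen_isDisconjugate hℓ).preimage (by fun_prop)
  set lam := sSup S with hlam
  have hlt : ∀ mu < lam, IsDisconjugate (q - mu • one ℓ) := by
    intro mu hmu
    obtain ⟨nu, hnu, hle⟩ := exists_lt_of_lt_csSup hne hmu
    exact IsDisconjugate.sub_smul_one_of_le hℓ hnu hle.le
  refine ⟨lam, ?_, hlt⟩
  have hnot : lam ∉ S := by
    intro hmem
    have hev : ∀ᶠ mu in 𝓝[>] lam, mu ∈ S := nhdsWithin_le_nhds (hopen.mem_nhds hmem)
    obtain ⟨mu, hmu, hmu'⟩ := (hev.and self_mem_nhdsWithin).exists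
    exact absurd (le_csSup hbdd hmu) (not_le.2 hmu')
  obtain ⟨c, hc, hc0⟩ : ∃ c ∈ Ioc 0 ℓ, sol (q - lam • one ℓ) c = 0 := by
    by_contra! hcon
    exact hnot (isDisconjugate_of_ne_zero hℓ hcon)
  rcases hc.2.eq_or_lt with rfl | hcℓ
  · exact hc0
  exfalso
  refine solDeriv_ne_zero hℓ hc hc0 ?_
  have hmin : IsLocalMin (sol (q - lam • one ℓ)) c := by
    filter_upwards [Ioo_mem_nhds hc.1 hcℓ] with x hx
    rw [hc0]
    have hcont : Continuous fun mu : ℝ => sol (q - mu • one ℓ) x :=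
      (continuous_sol_apply hℓ x).comp (by fun_prop)
    refine ge_of_tendsto (hcont.continuousAt.tendsto.mono_left
      (nhdsWithin_le_nhds (s := Iio lam))) ?_
    filter_upwards [self_mem_nhdsWithin] with mu hmu
    exact (hlt mu hmu x ⟨hx.1, hx.2.le⟩).le
  exact hmin.hasDerivAt_eq_zero (hasDerivAt_sol _ ⟨hc.1, hcℓ⟩)

theorem isLeast_first_eigenvalue (hℓ : 0 < ℓ) {q : Potential ℓ} {lam : ℝ}
    (h0 : sol (q - lam • one ℓ) ℓ = 0) (hlt : ∀ mu < lam, IsDisconjugate (q - mu • one ℓ)) :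
    IsLeast {lam : ℝ | IsDirichletEigenvalue ℓ q lam} lam := by
  refine ⟨(isDirichletEigenvalue_iff hℓ q lam).2 h0, fun mu hmu => ?_⟩
  by_contra! hcon
  exact (hlt mu hcon ℓ (right_mem_Ioc.2 hℓ)).ne' ((isDirichletEigenvalue_iff hℓ q mu).1 hmu)

theorem isLeast_firstDirichletEigenvalue (hℓ : 0 < ℓ) (q : Potential ℓ) :
    IsLeast {lam : ℝ | IsDirichletEigenvalue ℓ q lam} (firstDirichletEigenvalue ℓ q) := by
  obtain ⟨lam, h0, hlt⟩ := exists_first_eigenvalue hℓ q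
  have h := isLeast_first_eigenvalue hℓ h0 hlt
  rw [firstDirichletEigenvalue, h.csInf_eq]
  exact h

theorem sol_firstDirichletEigenvalue (hℓ : 0 < ℓ) (q : Potential ℓ) :
    sol (q - firstDirichletEigenvalue ℓ q • one ℓ) ℓ = 0 :=
  (isDirichletEigenvalue_iff hℓ q _).1 (isLeast_firstDirichletEigenvalue hℓ q).1

theorem isDisconjugate_iff_lt_firstDirichletEigenvalue (hℓ : 0 < ℓ) (q : Potential ℓ) (mu : ℝ) :
    IsDisconjugate (q - mu • one ℓ) ↔ mu < firstDirichletEigenvalue ℓ q := by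
  constructor
  · intro h
    by_contra! hle
    exact (IsDisconjugate.sub_smul_one_of_le hℓ h hle ℓ (right_mem_Ioc.2 hℓ)).ne'
      (sol_firstDirichletEigenvalue hℓ q)
  · obtain ⟨lam, h0, hlt⟩ := exists_first_eigenvalue hℓ q
    rw [(isLeast_firstDirichletEigenvalue hℓ q).unique (isLeast_first_eigenvalue hℓ h0 hlt)]
    exact hlt mu

theorem concaveOn_firstDirichletEigenvalue (hℓ : 0 < ℓ) :
    ConcaveOn ℝ univ (firstDirichletEigenvalue ℓ) := by
  refine ⟨convex_univ, fun q₀ _ q₁ _ a b ha hb hab => ?_⟩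
  -- The shift by λ₁ itself is not disconjugate; lowering it by ε makes the threshold criterion
  -- applicable.
  refine le_of_forall_pos_lt_add fun ε hε => ?_
  rw [← sub_lt_iff_lt_add, ← isDisconjugate_iff_lt_firstDirichletEigenvalue hℓ]
  have h₀ := (isDisconjugate_iff_lt_firstDirichletEigenvalue hℓ q₀ _).2 (sub_lt_self _ hε)
  have h₁ := (isDisconjugate_iff_lt_firstDirichletEigenvalue hℓ q₁ _).2 (sub_lt_self _ hε)
  refine h₀.of_convexCombination_le hℓ h₁ ha hb hab ?_
  filter_upwards [sub_smul_one_apply q₀ (firstDirichletEigenvalue ℓ q₀ - ε),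
    sub_smul_one_apply q₁ (firstDirichletEigenvalue ℓ q₁ - ε),
    sub_smul_one_apply (a • q₀ + b • q₁) (a • firstDirichletEigenvalue ℓ q₀ +
      b • firstDirichletEigenvalue ℓ q₁ - ε),
    Lp.coeFn_add (a • q₀) (b • q₁), Lp.coeFn_smul a q₀, Lp.coeFn_smul b q₁]
    with x h1 h2 h3 h4 h5 h6
  rw [h1, h2, h3, h4, Pi.add_apply, h5, h6, Pi.smul_apply, Pi.smul_apply]
  simp only [smul_eq_mul]
  refine le_of_eq ?_
  linear_combination ε * hab

/-! ### Smoothness through the implicit function theorem -/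

theorem _root_.ContinuousLinearMap.isInvertible_of_apply_one_ne_zero {A : ℝ →L[ℝ] ℝ}
    (h : A 1 ≠ 0) : A.IsInvertible := by
  refine ContinuousLinearMap.IsInvertible.of_inverse
    (g := (A 1)⁻¹ • ContinuousLinearMap.id ℝ ℝ) ?_ ?_
  · ext
    simp [h]
  · ext
    simp [h]

theorem contDiff_firstDirichletEigenvalue (hℓ : 0 < ℓ) :
    ContDiff ℝ 2 (firstDirichletEigenvalue ℓ) := by
  refine contDiff_iff_contDiffAt.2 fun q => ?_
  set lam := firstDirichletEigenvalue ℓ q with hlam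
  set f : Potential ℓ × ℝ → ℝ := fun v => sol (v.1 - v.2 • one ℓ) ℓ with hf
  have hf0 : ∀ x, f (x, firstDirichletEigenvalue ℓ x) = 0 := sol_firstDirichletEigenvalue hℓ
  have hfc : ContDiff ℝ 2 f := by
    have h1 : ContDiff ℝ 2 (sol : Potential ℓ → ℝ →ᵇ ℝ) := contDiff_sol hℓ (n := 2)
    have h2 : ContDiff ℝ 2 fun v : Potential ℓ × ℝ => v.1 - v.2 • one ℓ := by fun_prop
    exact (BoundedContinuousFunction.evalCLM ℝ ℓ).contDiff.comp (h1.comp h2)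
  have hfat : ContDiffAt ℝ 2 f (q, lam) := hfc.contDiffAt
  have hinv : (fderiv ℝ f (q, lam) ∘L .inr ℝ (Potential ℓ) ℝ).IsInvertible := by
    refine ContinuousLinearMap.isInvertible_of_apply_one_ne_zero fun h0 => ?_
    have hfd : HasFDerivAt f (fderiv ℝ f (q, lam)) (q, lam + 0) := by
      rw [add_zero]
      exact (hfc.differentiable (by norm_num) _).hasFDerivAt
    have hline : HasDerivAt (fun t : ℝ => (q, lam + t)) ((0 : Potential ℓ), (1 : ℝ)) 0 :=
      (hasDerivAt_const 0 q).prodMk ((hasDerivAt_id (0 : ℝ)).const_add lam)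
    have h1 := hfd.comp_hasDerivAt (0 : ℝ) hline
    have h0' : fderiv ℝ f (q, lam) (0, 1) = 0 := h0
    rw [h0'] at h1
    have hc : ℓ ∈ Ioc 0 ℓ := right_mem_Ioc.2 hℓ
    have h2 := hasDerivAt_solDeriv_mul_sol hℓ (p := q - lam • one ℓ) hc (hf0 q)
    have h3 := h1.const_mul (solDeriv (q - lam • one ℓ) ℓ)
    rw [mul_zero] at h3
    refine (integral_sol_mul_sol_pos hℓ (q - lam • one ℓ) hc).ne' (h2.unique ?_)
    refine h3.congr_of_eventuallyEq (Eventually.of_forall fun t => ?_)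
    simp only [Function.comp, hf, add_smul, sub_sub]
  set ψ := hfat.implicitFunction two_ne_zero hinv with hψ
  have hψc : ContDiffAt ℝ 2 ψ q := hfat.contDiffAt_implicitFunction two_ne_zero hinv
  have hψq : ψ q = lam := hfat.implicitFunction_apply_self two_ne_zero hinv
  have hψ0 : ∀ᶠ x in 𝓝 q, f (x, ψ x) = f (q, lam) :=
    hfat.eventually_apply_implicitFunction two_ne_zero hinv
  have huniq : ∀ᶠ v in 𝓝 (q, lam), f v = f (q, lam) ↔ ψ v.1 = v.2 :=
    hfat.eventually_apply_eq_iff_implicitFunction two_ne_zero hinv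
  -- Local uniqueness only identifies zeros close to (q, lam), so continuity of λ₁ at q is needed
  -- first. The lower bound is openness of disconjugacy; the upper one holds because ψ x is an
  -- eigenvalue of x, hence at least λ₁(x).
  have htend : Tendsto (firstDirichletEigenvalue ℓ) (𝓝 q) (𝓝 lam) := by
    refine tendsto_order.2 ⟨fun a ha => ?_, fun a ha => ?_⟩
    · have hopen : IsOpen {x : Potential ℓ | IsDisconjugate (x - a • one ℓ)} :=
        (isOpen_isDisconjugate hℓ).preimage (by fun_prop)
      filter_upwards [hopen.mem_nhds
        ((isDisconjugate_iff_lt_firstDirichletEigenvalue hℓ q a).2 ha)] with x hx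
      exact (isDisconjugate_iff_lt_firstDirichletEigenvalue hℓ x a).1 hx
    · filter_upwards [hψ0, hψc.continuousAt.eventually (gt_mem_nhds (hψq.trans_lt ha))]
        with x hx hxa
      refine lt_of_le_of_lt ((isLeast_firstDirichletEigenvalue hℓ x).2 ?_) hxa
      exact (isDirichletEigenvalue_iff hℓ x _).2 (hx.trans (hf0 q))
  refine hψc.congr_of_eventuallyEq ?_
  filter_upwards [(tendsto_id.prodMk_nhds htend).eventually huniq] with x hx
  exact (hx.1 ((hf0 x).trans (hf0 q).symm)).symm

end Potential

/-! ### Sign of the second derivative -/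

theorem secondFrechetDeriv_nonpos_of_concaveOn {E : Type*} [NormedAddCommGroup E]
    [NormedSpace ℝ E] {F : E → ℝ} (hF : ContDiff ℝ 2 F) (hc : ConcaveOn ℝ univ F) (q h : E) :
    secondFrechetDeriv F q h ≤ 0 := by
  have hc' : ConcaveOn ℝ univ (fun s : ℝ => F (q + s • h)) := by
    refine ⟨convex_univ, fun s _ t _ a b ha hb hab => ?_⟩
    have := hc.2 (mem_univ (q + s • h)) (mem_univ (q + t • h)) ha hb hab
    convert this using 2
    obtain rfl : b = 1 - a := by linarith
    simp only [smul_eq_mul]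
    module
  have hd : Differentiable ℝ (fun s : ℝ => F (q + s • h)) :=
    (hF.comp (by fun_prop : ContDiff ℝ 2 fun s : ℝ => q + s • h)).differentiable (by norm_num)
  rw [secondFrechetDeriv, iteratedDeriv_succ, iteratedDeriv_one]
  exact (antitoneOn_univ.1 (hc'.antitoneOn_deriv fun x _ => hd x)).deriv_nonpos

theorem theorem3p1 (ℓ : ℝ) (hℓ : 0 < ℓ) :
    (∀ q : Potential ℓ,
      IsLeast {lam : ℝ | IsDirichletEigenvalue ℓ q lam} (firstDirichletEigenvalue ℓ q)) ∧
    ContDiff ℝ 2 (firstDirichletEigenvalue ℓ) ∧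
    ∀ q h : Potential ℓ, secondFrechetDeriv (firstDirichletEigenvalue ℓ) q h ≤ 0 :=
  ⟨Potential.isLeast_firstDirichletEigenvalue hℓ, Potential.contDiff_firstDirichletEigenvalue hℓ,
    secondFrechetDeriv_nonpos_of_concaveOn (Potential.contDiff_firstDirichletEigenvalue hℓ)
      (Potential.concaveOn_firstDirichletEigenvalue hℓ)⟩
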